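/- Let $\mathbb{K}\in\{\mathbb{R},\mathbb{C}\}$, let $I$ be an arbitrary set, and let $X=\mathbb{K}^I$ carry the product topology (for example $X=\omega=\mathbb{K}^{\mathbb{N}}$). Let $T=(T_t)_{t\ge 0}$ be a strongly continuous semigroup on $X$, i.e. a family of continuous linear operators $T_t:X\to X$ with $T_0=\mathrm{id}_X$, $T_{s+t}=T_s\circ T_t$ for all $s,t\ge 0$, and such that $t\mapsto T_t(x)$ is continuous on $[0,\infty)$ for every $x\in X$. Let $(A,D(A))$ be its generator: $D(A)$ is the set of all $x\in X$ for which $A(x)=\lim_{t\downarrow 0}\frac1t\,(T_t(x)-x)$ exists in $X$. Then $D(A)=X$, the linear operator $A:X\to X$ is continuous, and for all $t\ge 0$ and $x\in X$ $$T_t(x)=\exp(tA)(x)=\sum_{k=0}^{\infty}\frac{t^k}{k!}A^k(x),$$ where the series converges unconditionally in $X$. In particular, this holds on $\omega=\mathbb{K}^{\mathbb{N}}$, so every strongly continuous semigroup on $\omega$ is of the form $T_t=\exp(tA)$ with a continuous linear operator $A$ on $\omega$ (an affirmative answer to Conejero's question). -/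

import Mathlib

open Filter Topology
open scoped NNReal Nat

/-- A strongly continuous (one-parameter) semigroup of continuous linear operators on a
topological vector space `X`: a family `T t`, `t ≥ 0`, with `T 0 = id`, `T (s + t) = T s ∘ T t`
and continuous orbits `t ↦ T t x`. -/
structure StronglyContinuousSemigroup (𝕜 : Type*) (X : Type*) [RCLike 𝕜] [AddCommGroup X]
    [Module 𝕜 X] [TopologicalSpace X] where
  /-- The operator at time `t`. -/
  op : ℝ≥0 → X →L[𝕜] X
  op_zero : op 0 = ContinuousLinearMap.id 𝕜 X
  op_add : ∀ s t : ℝ≥0, op (s + t) = (op s).comp (op t)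
  continuous_orbit : ∀ x : X, Continuous fun t : ℝ≥0 => op t x

namespace StronglyContinuousSemigroup

variable {𝕜 : Type*} {X : Type*} [RCLike 𝕜] [AddCommGroup X] [Module 𝕜 X] [TopologicalSpace X]

/-- `y` is the (right) derivative at `0` of the orbit of `x`:
`(T t x - x) / t → y` as `t → 0`, `t > 0`. -/
def HasOrbitDeriv (T : StronglyContinuousSemigroup 𝕜 X) (x y : X) : Prop :=
  Tendsto (fun t : ℝ≥0 => (((t : ℝ) : 𝕜)⁻¹) • (T.op t x - x)) (𝓝[>] 0) (𝓝 y)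

theorem HasOrbitDeriv.unique [T2Space X] {T : StronglyContinuousSemigroup 𝕜 X} {x y z : X}
    (hy : T.HasOrbitDeriv x y) (hz : T.HasOrbitDeriv x z) : y = z :=
  tendsto_nhds_unique hy hz

theorem HasOrbitDeriv.add [IsTopologicalAddGroup X] {T : StronglyContinuousSemigroup 𝕜 X}
    {x y x' y' : X} (h : T.HasOrbitDeriv x y) (h' : T.HasOrbitDeriv x' y') :
    T.HasOrbitDeriv (x + x') (y + y') := by
  refine (Tendsto.add h h').congr fun t => ?_
  rw [← smul_add, map_add]
  congr 1
  abel

theorem HasOrbitDeriv.smul [ContinuousSMul 𝕜 X] {T : StronglyContinuousSemigroup 𝕜 X}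
    {x y : X} (c : 𝕜) (h : T.HasOrbitDeriv x y) : T.HasOrbitDeriv (c • x) (c • y) := by
  refine (Tendsto.const_smul h c).congr fun t => ?_
  rw [map_smul, ← smul_sub, smul_comm]

theorem hasOrbitDeriv_zero (T : StronglyContinuousSemigroup 𝕜 X) : T.HasOrbitDeriv 0 0 := by
  simpa [HasOrbitDeriv] using tendsto_const_nhds

variable [IsTopologicalAddGroup X] [ContinuousSMul 𝕜 X] [T2Space X]

/-- The (infinitesimal) generator `(A, D(A))` of a strongly continuous semigroup, as a partially
defined linear operator: `D(A)` consists of all `x` whose orbit has a derivative at `0`, and `A x`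
is that derivative. -/
noncomputable def generator (T : StronglyContinuousSemigroup 𝕜 X) : X →ₗ.[𝕜] X where
  domain :=
    { carrier := {x | ∃ y, T.HasOrbitDeriv x y}
      add_mem' := fun ⟨_, h⟩ ⟨_, h'⟩ => ⟨_, h.add h'⟩
      zero_mem' := ⟨0, T.hasOrbitDeriv_zero⟩
      smul_mem' := fun c _ ⟨_, h⟩ => ⟨_, h.smul c⟩ }
  toFun :=
    { toFun := fun x => x.2.choose
      map_add' := fun x x' =>
        (x + x').2.choose_spec.unique (x.2.choose_spec.add x'.2.choose_spec)
      map_smul' := fun c x => (c • x).2.choose_spec.unique (x.2.choose_spec.smul c) }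

theorem mem_generator_domain (T : StronglyContinuousSemigroup 𝕜 X) {x : X} :
    x ∈ T.generator.domain ↔ ∃ y, T.HasOrbitDeriv x y :=
  Iff.rfl

theorem hasOrbitDeriv_generator (T : StronglyContinuousSemigroup 𝕜 X)
    (x : T.generator.domain) : T.HasOrbitDeriv (x : X) (T.generator x) :=
  x.2.choose_spec

end StronglyContinuousSemigroup

/-! Pass to the dual. Continuous functionals on `I → 𝕜` are finite combinations of coordinates, so
every linear functional on that dual is evaluation at a point, and a pointwise bounded set of
functionals has finite-dimensional span. Continuity of orbits makes `{f ∘ T t | t ≤ s}` pointwise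
bounded. A minimal-dimension argument then puts each `f` in a finite-dimensional space invariant
under the transposed semigroup, which acts there as `exp (t b)` for a matrix `b`. Applied to the
coordinate functionals, this yields the generator and the series one coordinate at a time. -/

/-! ### Norm-continuous semigroups in Banach algebras -/

section BanachAlgebra

open MeasureTheory intervalIntegral

variable {R : Type*} [NormedRing R] [NormedAlgebra ℝ R] [CompleteSpace R]

/-- A norm-continuous one-parameter semigroup in a Banach algebra is an exponential. -/
theorem exists_eq_exp_of_continuous_semigroup {g : ℝ≥0 → R} (hg : Continuous g) (h0 : g 0 = 1)
    (hadd : ∀ s t, g (s + t) = g s * g t) :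
    ∃ b : R, ∀ t : ℝ≥0, g t = NormedSpace.exp ((t : ℝ) • b) := by
  set G : ℝ → R := fun t => g t.toNNReal with hG
  have hGc : Continuous G := hg.comp continuous_real_toNNReal
  have hG0 : G 0 = 1 := by simp [hG, h0]
  have hGadd : ∀ s t : ℝ, 0 ≤ s → 0 ≤ t → G (s + t) = G s * G t := fun s t hs ht => by
    simp only [hG, Real.toNNReal_add hs ht, hadd]
  set P : ℝ → R := fun t => ∫ u in (0 : ℝ)..t, G u with hP
  have hPd : ∀ t, HasDerivAt P (G t) t := fun t =>
    integral_hasDerivAt_right (hGc.intervalIntegrable _ _)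
      (hGc.stronglyMeasurableAtFilter _ _) hGc.continuousAt
  -- `P h / h` tends to `G 0 = 1`, and units form an open set.
  obtain ⟨h, hh, hu⟩ : ∃ h : ℝ, 0 < h ∧ IsUnit (P h) := by
    have h1 : Tendsto (fun h : ℝ => h⁻¹ • P h) (𝓝[>] 0) (𝓝 1) := by
      have := (hPd 0).tendsto_slope_zero_right
      simpa [hP, hG0] using this
    have h2 : ∀ᶠ h : ℝ in 𝓝[>] 0, IsUnit (h⁻¹ • P h) :=
      h1.eventually (Units.isOpen.mem_nhds isUnit_one)
    obtain ⟨h, hU, hpos⟩ := (h2.and self_mem_nhdsWithin).exists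
    have hpos : 0 < h := hpos
    refine ⟨h, hpos, ?_⟩
    have := hU.smul (Units.mk0 h hpos.ne')
    simpa [Units.smul_def, smul_smul, hpos.ne'] using this
  obtain ⟨m, hm⟩ := hu
  -- Since `G t * P h` is the integral of `G` over `[t, t + h]`, `G` inherits differentiability from
  -- `P`.
  have hGP : ∀ t, 0 ≤ t → G t = (P (t + h) - P t) * ↑m⁻¹ := by
    intro t ht
    rw [Units.eq_mul_inv_iff_mul_eq, hm]
    simp only [hP]
    rw [integral_interval_sub_left (hGc.intervalIntegrable _ _) (hGc.intervalIntegrable _ _)]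
    have := integral_comp_add_left (a := 0) (b := h) G t
    rw [add_zero] at this
    rw [← this]
    refine ((ContinuousLinearMap.mul ℝ R (G t)).intervalIntegral_comp_comm
      (hGc.intervalIntegrable _ _)).symm.trans ?_
    refine integral_congr fun u hu => ?_
    rw [Set.uIcc_of_le hh.le] at hu
    exact (hGadd t u ht hu.1).symm
  set b : R := (G h - 1) * ↑m⁻¹ with hb
  have hGd : ∀ t, 0 ≤ t → HasDerivWithinAt G (G t * b) (Set.Ici t) t := by
    intro t ht
    have h1 : HasDerivAt (fun t => (P (t + h) - P t) * ↑m⁻¹) (G t * b) t := by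
      have h2 : HasDerivAt (fun t => P (t + h)) (G (t + h)) t :=
        (hPd (t + h)).comp_add_const t h
      have h3 := (h2.fun_sub (hPd t)).mul_const (↑m⁻¹ : R)
      rwa [hGadd t h ht hh.le, ← mul_sub_one, mul_assoc] at h3
    exact h1.hasDerivWithinAt.congr (fun s hs => hGP s (ht.trans hs)) (hGP t ht)
  refine ⟨b, fun t => ?_⟩
  have hexp : ∀ s : ℝ, HasDerivAt (fun s : ℝ => NormedSpace.exp (s • (-b)))
      ((-b) * NormedSpace.exp (s • (-b))) s := fun s => hasDerivAt_exp_smul_const' (-b) s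
  have hH : G t * NormedSpace.exp ((t : ℝ) • (-b)) = 1 := by
    have key := constant_of_has_deriv_right_zero
      (f := fun s => G s * NormedSpace.exp (s • (-b))) (a := 0) (b := t)
      (hGc.mul (continuous_iff_continuousAt.2 fun s => (hexp s).continuousAt)).continuousOn
      (fun s hs => by
        have h3 := (hGd s hs.1).fun_mul (hexp s).hasDerivWithinAt
        rwa [neg_mul, mul_neg, mul_assoc, add_neg_cancel] at h3) t ⟨t.2, le_rfl⟩
    simpa [hG0] using key
  have hinv : NormedSpace.exp ((t : ℝ) • (-b)) * NormedSpace.exp ((t : ℝ) • b) = 1 := by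
    let : NormedAlgebra ℚ R := NormedAlgebra.restrictScalars ℚ ℝ R
    rw [← NormedSpace.exp_add_of_commute, ← smul_add]
    · simp
    · exact ((Commute.refl b).neg_left.smul_left _).smul_right _
  calc g t = G t := by simp [hG]
    _ = G t * (NormedSpace.exp ((t : ℝ) • (-b)) * NormedSpace.exp ((t : ℝ) • b)) := by
      rw [hinv, mul_one]
    _ = _ := by rw [← mul_assoc, hH, one_mul]

theorem exists_eq_exp_coe_smul_of_continuous_semigroup {𝕜 R : Type*} [RCLike 𝕜] [NormedRing R]
    [NormedAlgebra 𝕜 R] [CompleteSpace R] {g : ℝ≥0 → R} (hg : Continuous g) (h0 : g 0 = 1)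
    (hadd : ∀ s t, g (s + t) = g s * g t) :
    ∃ b : R, ∀ t : ℝ≥0, g t = NormedSpace.exp (((t : ℝ) : 𝕜) • b) := by
  let : NormedAlgebra ℝ R := NormedAlgebra.restrictScalars ℝ 𝕜 R
  obtain ⟨b, hb⟩ := exists_eq_exp_of_continuous_semigroup hg h0 hadd
  exact ⟨b, fun t => hb t⟩

theorem hasDerivAt_exp_smul_zero {𝕜 R : Type*} [RCLike 𝕜] [NormedRing R] [NormedAlgebra 𝕜 R]
    [CompleteSpace R] (b : R) : HasDerivAt (fun s : 𝕜 => NormedSpace.exp (s • b)) b 0 := by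
  simpa using hasDerivAt_exp_smul_const (𝕂 := 𝕜) b 0

theorem hasSum_exp_smul {𝕜 R : Type*} [RCLike 𝕜] [NormedRing R] [NormedAlgebra 𝕜 R]
    [CompleteSpace R] (c : 𝕜) (b : R) :
    HasSum (fun k : ℕ => (c ^ k / (k ! : 𝕜)) • b ^ k) (NormedSpace.exp (c • b)) := by
  convert NormedSpace.exp_series_hasSum_exp' (𝕂 := 𝕜) (c • b) using 2 with k
  rw [smul_pow, smul_smul, div_eq_inv_mul]

theorem exp_zero_smul {𝕜 R : Type*} [RCLike 𝕜] [NormedRing R] [NormedAlgebra 𝕜 R] (b : R) :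
    NormedSpace.exp ((0 : 𝕜) • b) = 1 := by
  rw [zero_smul, NormedSpace.exp_zero]

end BanachAlgebra

/-! ### The dual of a product of lines -/

section Dual

variable {𝕜 : Type*} [RCLike 𝕜] {I : Type*}

/-- A continuous functional on a product of copies of the field is a linear combination of
coordinates. -/
theorem span_range_proj_eq_top :
    Submodule.span 𝕜 (Set.range fun i : I =>
      (ContinuousLinearMap.proj i : (I → 𝕜) →L[𝕜] 𝕜)) = ⊤ := by
  classical
  refine Submodule.eq_top_iff'.2 fun f => ?_
  have hf : {x | ‖f x‖ < 1} ∈ 𝓝 (0 : I → 𝕜) :=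
    (f.continuous.norm.isOpen_preimage _ isOpen_Iio).mem_nhds (by simp)
  rw [nhds_pi, Filter.mem_pi] at hf
  obtain ⟨F, hF, u, hu, hsub⟩ := hf
  -- The neighbourhood contains the whole subspace vanishing on `F`; rescaling `x` to have value `1`
  -- contradicts the bound.
  have hker : ∀ x : I → 𝕜, (∀ i ∈ F, x i = 0) → f x = 0 := by
    intro x hx
    by_contra hne
    have := hsub (show (f x)⁻¹ • x ∈ F.pi u from fun i hi => by
      simpa [hx i hi] using mem_of_mem_nhds (hu i))
    simp [hne] at this
  have : f = ∑ i ∈ hF.toFinset, f (Pi.single i 1) •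
      (ContinuousLinearMap.proj i : (I → 𝕜) →L[𝕜] 𝕜) := by
    ext x
    have h := hker (x - ∑ i ∈ hF.toFinset, x i • Pi.single i (1 : 𝕜)) fun j hj => by
      simp [Finset.sum_apply, Pi.single_apply, hj]
    rw [map_sub, sub_eq_zero, map_sum] at h
    rw [h]
    simp [mul_comm]
  rw [this]
  exact Submodule.sum_mem _ fun i _ => Submodule.smul_mem _ _ (Submodule.subset_span ⟨i, rfl⟩)

/-- Every linear functional on the topological dual of `I → 𝕜` is a point evaluation. -/
theorem exists_eval_eq (ψ : ((I → 𝕜) →L[𝕜] 𝕜) →ₗ[𝕜] 𝕜) : ∃ x : I → 𝕜, ∀ f, ψ f = f x := by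
  refine ⟨fun i => ψ (ContinuousLinearMap.proj i), fun f => ?_⟩
  have hf : f ∈ Submodule.span 𝕜 (Set.range fun i : I =>
      (ContinuousLinearMap.proj i : (I → 𝕜) →L[𝕜] 𝕜)) := by
    rw [span_range_proj_eq_top]; trivial
  induction hf using Submodule.span_induction with
  | mem f hf => obtain ⟨i, rfl⟩ := hf; rfl
  | zero => simp
  | add f g _ _ hf hg => simp [hf, hg]
  | smul c f _ hf => simp [hf]

/-- A pointwise bounded set of continuous functionals on `I → 𝕜` spans a finite-dimensional
space. -/
theorem finiteDimensional_span_of_pointwise_bounded {s : Set ((I → 𝕜) →L[𝕜] 𝕜)}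
    (hs : ∀ x, ∃ C : ℝ, ∀ f ∈ s, ‖f x‖ ≤ C) : FiniteDimensional 𝕜 (Submodule.span 𝕜 s) := by
  obtain ⟨b, hbs, hspan, hli⟩ := exists_linearIndependent 𝕜 s
  rw [← hspan]
  by_cases hfin : b.Finite
  · exact FiniteDimensional.span_of_finite 𝕜 hfin
  exfalso
  have hinf : Infinite b := Set.infinite_coe_iff.2 hfin
  have hu := hli.comp _ (Infinite.natEmbedding b).injective
  -- Prescribing the value `n` on the `n`-th independent functional gives a point where the set is
  -- unbounded.
  obtain ⟨ψ, hψ⟩ := ((Module.Basis.span hu).constr 𝕜 fun n : ℕ => (n : 𝕜)).exists_extend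
  obtain ⟨x, hx⟩ := exists_eval_eq ψ
  obtain ⟨C, hC⟩ := hs x
  obtain ⟨n, hn⟩ := exists_nat_gt C
  have hval : ψ (Infinite.natEmbedding b n : b) = (n : 𝕜) := by
    have h1 := LinearMap.congr_fun hψ (Module.Basis.span hu n)
    rw [Module.Basis.constr_basis, LinearMap.comp_apply, Submodule.subtype_apply,
      Module.Basis.span_apply] at h1
    exact h1
  have := hC _ (hbs (Infinite.natEmbedding b n).2)
  rw [← hx, hval, RCLike.norm_natCast] at this
  exact this.not_gt hn

end Dual

/-! ### The transposed semigroup and its invariant subspaces -/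

namespace StronglyContinuousSemigroup

variable {𝕜 : Type*} [RCLike 𝕜] {I : Type*}

/-- The span of the functionals `f ∘ T t` with `t ≤ s`. -/
def orbitSpan (T : StronglyContinuousSemigroup 𝕜 (I → 𝕜)) (f : (I → 𝕜) →L[𝕜] 𝕜) (s : ℝ≥0) :
    Submodule 𝕜 ((I → 𝕜) →L[𝕜] 𝕜) :=
  Submodule.span 𝕜 ((fun t => f.comp (T.op t)) '' Set.Iic s)

variable (T : StronglyContinuousSemigroup 𝕜 (I → 𝕜)) (f : (I → 𝕜) →L[𝕜] 𝕜)

theorem orbitSpan_mono : Monotone (T.orbitSpan f) := fun _ _ h =>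
  Submodule.span_mono (Set.image_mono (Set.Iic_subset_Iic.2 h))

theorem mem_orbitSpan (s : ℝ≥0) : f ∈ T.orbitSpan f s :=
  Submodule.subset_span ⟨0, Set.mem_Iic.2 zero_le, by simp [T.op_zero]⟩

theorem comp_mem_orbitSpan_add {r s : ℝ≥0} {v : (I → 𝕜) →L[𝕜] 𝕜} (hv : v ∈ T.orbitSpan f s) :
    v.comp (T.op r) ∈ T.orbitSpan f (s + r) := by
  induction hv using Submodule.span_induction with
  | mem v hv =>
    obtain ⟨t, ht, rfl⟩ := hv
    refine Submodule.subset_span ⟨t + r, add_le_add_left ht r, ?_⟩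
    simp only [T.op_add, ContinuousLinearMap.comp_assoc]
  | zero => simp
  | add u v _ _ hu hv => simpa [ContinuousLinearMap.add_comp] using add_mem hu hv
  | smul c v _ hv => simpa [ContinuousLinearMap.smul_comp] using Submodule.smul_mem _ c hv

/-- Each orbit is bounded on the compact interval `[0, s]`. -/
theorem finiteDimensional_orbitSpan (s : ℝ≥0) : FiniteDimensional 𝕜 (T.orbitSpan f s) := by
  refine finiteDimensional_span_of_pointwise_bounded fun x => ?_
  have hK : IsCompact (Set.Iic s) := by
    rw [← Set.Icc_bot]; exact isCompact_Icc
  obtain ⟨C, hC⟩ := hK.exists_bound_of_continuousOn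
    (f.continuous.comp (T.continuous_orbit x)).continuousOn
  refine ⟨C, ?_⟩
  rintro _ ⟨t, ht, rfl⟩
  exact hC t ht

/-- Every continuous functional lies in a finite-dimensional space invariant under the transposed
semigroup. -/
theorem exists_invariant_finiteDimensional :
    ∃ V : Submodule 𝕜 ((I → 𝕜) →L[𝕜] 𝕜), FiniteDimensional 𝕜 V ∧ f ∈ V ∧
      ∀ t, ∀ v ∈ V, v.comp (T.op t) ∈ V := by
  have := T.finiteDimensional_orbitSpan f
  -- At a positive `s` of least dimension, halving `s` leaves the span unchanged, so it is stable
  -- under times up to `s / 2`, hence under all times.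
  obtain ⟨s, hs, hmin⟩ := (measure fun s => Module.finrank 𝕜 (T.orbitSpan f s)).wf.has_min
    (Set.Ioi 0) ⟨1, Set.mem_Ioi.2 one_pos⟩
  have hs2 : 0 < s / 2 := half_pos hs
  have heq : T.orbitSpan f (s / 2) = T.orbitSpan f s :=
    Submodule.eq_of_le_of_finrank_le (T.orbitSpan_mono f (half_le_self hs.le))
      (not_lt.1 (hmin (s / 2) hs2))
  have hsmall : ∀ r ≤ s / 2, ∀ v ∈ T.orbitSpan f s, v.comp (T.op r) ∈ T.orbitSpan f s := by
    intro r hr v hv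
    rw [← heq] at hv
    refine T.orbitSpan_mono f ?_ (T.comp_mem_orbitSpan_add f (r := r) hv)
    exact (add_le_add_right hr _).trans (add_halves s).le
  refine ⟨T.orbitSpan f s, this s, T.mem_orbitSpan f s, fun t => ?_⟩
  obtain ⟨n, hn⟩ := Archimedean.arch t hs2
  induction n generalizing t with
  | zero => exact hsmall t (by simp at hn; simp [hn])
  | succ n ih =>
    intro v hv
    rcases le_total t (s / 2) with h | h
    · exact hsmall t h v hv
    · have ht : t = s / 2 + (t - s / 2) := (add_tsub_cancel_of_le h).symm
      rw [ht, T.op_add, ← ContinuousLinearMap.comp_assoc]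
      refine ih _ ?_ _ (hsmall _ le_rfl v hv)
      rw [succ_nsmul] at hn
      exact tsub_le_iff_right.2 hn

/-- On a finite-dimensional invariant space of functionals the transposed semigroup is an
exponential. -/
theorem exists_exp_model :
    ∃ (n : ℕ) (J : (Fin n → 𝕜) →ₗ[𝕜] ((I → 𝕜) →L[𝕜] 𝕜))
      (b : (Fin n → 𝕜) →L[𝕜] (Fin n → 𝕜)) (w : Fin n → 𝕜), J w = f ∧
      ∀ (t : ℝ≥0) (w : Fin n → 𝕜),
        (J w).comp (T.op t) = J (NormedSpace.exp (((t : ℝ) : 𝕜) • b) w) := by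
  obtain ⟨V, hV, hf, hinv⟩ := T.exists_invariant_finiteDimensional f
  have : Module.Free 𝕜 V := Module.Free.of_divisionRing 𝕜 V
  let L : V ≃ₗ[𝕜] (Fin (Module.finrank 𝕜 V) → 𝕜) := (Module.finBasis 𝕜 V).equivFun
  let S : ℝ≥0 → V →ₗ[𝕜] V := fun t =>
    { toFun := fun v => ⟨(v : (I → 𝕜) →L[𝕜] 𝕜).comp (T.op t), hinv t v v.2⟩
      map_add' := fun u v => Subtype.ext (ContinuousLinearMap.add_comp _ _ _)
      map_smul' := fun c v => Subtype.ext (ContinuousLinearMap.smul_comp _ _ _) }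
  let g : ℝ≥0 → (Fin (Module.finrank 𝕜 V) → 𝕜) →L[𝕜] (Fin (Module.finrank 𝕜 V) → 𝕜) := fun t =>
    LinearMap.toContinuousLinearMap (L.toLinearMap ∘ₗ S t ∘ₗ L.symm.toLinearMap)
  have hgS : ∀ t w, g t w = L (S t (L.symm w)) := fun _ _ => rfl
  have hg : Continuous g := by
    refine continuous_clm_apply.2 fun w => continuous_pi fun k => ?_
    -- A coordinate on `V` is evaluation at some `x`, so continuity of the entries of `g` reduces to
    -- that of the orbit of `x`.
    obtain ⟨ψ, hψ⟩ := (LinearMap.proj k ∘ₗ L.toLinearMap).exists_extend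
    obtain ⟨x, hx⟩ := exists_eval_eq ψ
    have : (fun t => g t w k) = fun t => (L.symm w : (I → 𝕜) →L[𝕜] 𝕜) (T.op t x) := by
      funext t
      have h1 := LinearMap.congr_fun hψ (S t (L.symm w))
      rw [LinearMap.comp_apply, hx] at h1
      exact h1.symm
    rw [this]
    exact (ContinuousLinearMap.continuous _).comp (T.continuous_orbit x)
  obtain ⟨b, hb⟩ := exists_eq_exp_coe_smul_of_continuous_semigroup (𝕜 := 𝕜) hg
    (by
      ext1 w
      rw [hgS]
      have : S 0 (L.symm w) = L.symm w := Subtype.ext (by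
        change ContinuousLinearMap.comp _ (T.op 0) = _
        rw [T.op_zero]; rfl)
      rw [this]; simp)
    (fun s t => by
      ext1 w
      rw [mul_apply_eq_comp, hgS, hgS, hgS, L.symm_apply_apply]
      congr 1
      refine Subtype.ext ?_
      change ContinuousLinearMap.comp _ (T.op (s + t)) = _
      -- Transposition reverses products, which is harmless because times commute.
      rw [add_comm, T.op_add]; rfl)
  refine ⟨_, V.subtype ∘ₗ L.symm.toLinearMap, b, L ⟨f, hf⟩, by simp, fun t w => ?_⟩
  have h1 : L.symm (g t w) = S t (L.symm w) := by rw [hgS, L.symm_apply_apply]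
  rw [← hb]
  exact (congrArg Subtype.val h1).symm

/-- Differentiation at `0` of an exponential representation of the transposed semigroup. -/
theorem tendsto_of_exp_model {T : StronglyContinuousSemigroup 𝕜 (I → 𝕜)} {n : ℕ}
    {J : (Fin n → 𝕜) →ₗ[𝕜] ((I → 𝕜) →L[𝕜] 𝕜)} {b : (Fin n → 𝕜) →L[𝕜] (Fin n → 𝕜)}
    (h : ∀ (t : ℝ≥0) (w : Fin n → 𝕜),
      (J w).comp (T.op t) = J (NormedSpace.exp (((t : ℝ) : 𝕜) • b) w))
    (w : Fin n → 𝕜) (x : I → 𝕜) :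
    Tendsto (fun t : ℝ≥0 => (((t : ℝ) : 𝕜)⁻¹) • (J w (T.op t x) - J w x)) (𝓝[>] 0)
      (𝓝 (J (b w) x)) := by
  let ℓ : (Fin n → 𝕜) →L[𝕜] 𝕜 := LinearMap.toContinuousLinearMap
    (LinearMap.flip (ContinuousLinearMap.coeLM 𝕜 ∘ₗ J) x)
  have hℓ : ∀ v, ℓ v = J v x := fun _ => rfl
  have hd : HasDerivAt (fun s : 𝕜 => ℓ (NormedSpace.exp (s • b) w)) (ℓ (b w)) 0 := by
    have h1 := hasDerivAt_exp_smul_zero (𝕜 := 𝕜) b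
    exact ℓ.hasFDerivAt.comp_hasDerivAt 0
      ((ContinuousLinearMap.apply 𝕜 (Fin n → 𝕜) w).hasFDerivAt.comp_hasDerivAt (0 : 𝕜) h1)
  have hcoe : Tendsto (fun t : ℝ≥0 => ((t : ℝ) : 𝕜)) (𝓝[>] 0) (𝓝[≠] 0) := by
    refine tendsto_nhdsWithin_iff.2 ⟨?_, ?_⟩
    · have : Continuous fun t : ℝ≥0 => ((t : ℝ) : 𝕜) :=
        RCLike.continuous_ofReal.comp NNReal.continuous_coe
      simpa using (this.tendsto 0).mono_left nhdsWithin_le_nhds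
    · filter_upwards [self_mem_nhdsWithin] with t ht
      have ht : 0 < t := ht
      simp [ht.ne']
  refine (hd.tendsto_slope_zero.comp hcoe).congr fun t => ?_
  have h2 : J w (T.op t x) = ℓ (NormedSpace.exp (((t : ℝ) : 𝕜) • b) w) := by
    rw [hℓ, ← h]; rfl
  have h3 : ℓ (NormedSpace.exp ((0 : 𝕜) • b) w) = J w x := by
    have h4 : NormedSpace.exp ((0 : 𝕜) • b) = 1 := exp_zero_smul b
    rw [h4, hℓ]; rfl
  simp only [Function.comp_apply, zero_add, h2, h3]

/-- The orbits are differentiable at `0`, and the derivative is a continuous operator. -/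
theorem exists_forall_hasOrbitDeriv :
    ∃ A : (I → 𝕜) →L[𝕜] (I → 𝕜), ∀ x, T.HasOrbitDeriv x (A x) := by
  choose n J b w hw h using fun i : I => T.exists_exp_model (ContinuousLinearMap.proj i)
  refine ⟨ContinuousLinearMap.pi fun i => J i (b i (w i)), fun x => tendsto_pi_nhds.2 fun i => ?_⟩
  have := tendsto_of_exp_model (h i) (w i) x
  rw [hw i] at this
  exact this

/-- By uniqueness of limits, `J` intertwines `b` with the transpose of `A`. Each coordinate of the
series is thus the image of the matrix series for `exp (t b)` under a continuous functional. -/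
theorem hasSum_of_hasOrbitDeriv {T : StronglyContinuousSemigroup 𝕜 (I → 𝕜)}
    {A : (I → 𝕜) →L[𝕜] (I → 𝕜)} (hA : ∀ x, T.HasOrbitDeriv x (A x)) (t : ℝ≥0) (x : I → 𝕜) :
    HasSum (fun k : ℕ => (((t : ℝ) : 𝕜) ^ k / (k ! : 𝕜)) • (A ^ k) x) (T.op t x) := by
  refine Pi.hasSum.2 fun i => ?_
  obtain ⟨n, J, b, w, hw, h⟩ := T.exists_exp_model (ContinuousLinearMap.proj i)
  have hJ : ∀ u y, J u (A y) = J (b u) y := fun u y => by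
    refine tendsto_nhds_unique ((((J u).continuous.tendsto _).comp (hA y)).congr fun t => ?_)
      (tendsto_of_exp_model h u y)
    simp
  have hpow : ∀ (k : ℕ) (u) (y), J u ((A ^ k) y) = J ((b ^ k) u) y := by
    intro k
    induction k with
    | zero => simp
    | succ k ih =>
      intro u y
      rw [pow_succ', pow_succ, mul_apply_eq_comp,
        mul_apply_eq_comp, hJ, ih]
  let ℓ : (Fin n → 𝕜) →L[𝕜] 𝕜 := LinearMap.toContinuousLinearMap
    (LinearMap.flip (ContinuousLinearMap.coeLM 𝕜 ∘ₗ J) x)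
  have hℓ : ∀ v, ℓ v = J v x := fun _ => rfl
  have hsum := hasSum_exp_smul ((t : ℝ) : 𝕜) b
  have h2 := (hsum.mapL (ContinuousLinearMap.apply 𝕜 (Fin n → 𝕜) w)).mapL ℓ
  have h3 : T.op t x i = ℓ (NormedSpace.exp (((t : ℝ) : 𝕜) • b) w) := by
    rw [hℓ, ← h, hw]; rfl
  rw [h3]
  refine Eq.subst (motive := fun F => HasSum F _) (funext fun k => ?_) h2
  have h4 : (A ^ k) x i = ℓ ((b ^ k) w) := by
    rw [hℓ, ← hpow, hw]; rfl
  rw [map_smul, map_smul, Pi.smul_apply, h4]; rfl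

end StronglyContinuousSemigroup

theorem mainTheorem2 {𝕜 : Type*} [RCLike 𝕜] {I : Type*}
    (T : StronglyContinuousSemigroup 𝕜 (I → 𝕜)) :
    T.generator.domain = ⊤ ∧
      ∃ A : (I → 𝕜) →L[𝕜] (I → 𝕜),
        (∀ x : T.generator.domain, T.generator x = A (x : I → 𝕜)) ∧
          ∀ (t : ℝ≥0) (x : I → 𝕜),
            HasSum (fun k : ℕ => (((t : ℝ) : 𝕜) ^ k / (k ! : 𝕜)) • (A ^ k) x) (T.op t x) := by
  obtain ⟨A, hA⟩ := T.exists_forall_hasOrbitDeriv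
  exact ⟨Submodule.eq_top_iff'.2 fun x => ⟨A x, hA x⟩, A,
    fun x => (T.hasOrbitDeriv_generator x).unique (hA x),
    StronglyContinuousSemigroup.hasSum_of_hasOrbitDeriv hA⟩
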